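/- **Setting.** Let $d\ge 1$ and let $\|\cdot\|$ be the Euclidean norm on $\mathbb{R}^d$, $\mathbb{B}(x,r)$ the closed ball, $\mathbb{B}=\mathbb{B}(0,1)$. For a locally Lipschitz $f:\mathbb{R}^d\to\mathbb{R}$ let $f^{\circ}(x;v)=\limsup_{x'\to x,\,t\downarrow0}\frac{f(x'+tv)-f(x')}{t}$, let $\partial_Cf(x)=\{s:\langle s,v\rangle\le f^\circ(x;v)\ \forall v\in\mathbb{R}^d\}$ be the Clarke subdifferential and, for $\delta>0$, let $\partial_G^\delta f(x)=\mathrm{conv}\big(\bigcup_{y\in\mathbb{B}(x,\delta)}\partial_Cf(y)\big)$ be the Goldstein $\delta$-subdifferential. A function $f$ is *subdifferentially polynomially bounded (SPB) with parameters* $R_1\ge0$, $R_2>0$ and an integer $m\ge0$, where $R_1=0$ if and only if $m=0$, if it is locally Lipschitz and $$\sup_{\zeta\in\partial_Cf(x)}\|\zeta\|\le R_1\|x\|^m+R_2\qquad\forall x\in\mathbb{R}^d$$ (with $0^0=1$). For $\sigma>0$ its Gaussian smoothing is $f_\sigma(x)=\mathbb{E}_{u\sim\mathcal{N}(0,I)}[f(x+\sigma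 u)]$. Let $W_{-1}:[-1/e,0)\to(-\infty,-1]$ be the negative real branch of the Lambert $W$ function, i.e. the inverse of $t\mapsto te^t$ on $(-\infty,-1]$. **Theorem.** Let $f$ be SPB with parameters $R_1,R_2,m$. (i) For every $\sigma>0$ and $x\in\mathbb{R}^d$, the expectations below and the one defining $f_\sigma(x)$ exist, $f_\sigma$ is differentiable at $x$, and $$\nabla f_\sigma(x)=\sigma^{-1}\,\mathbb{E}_{u\sim\mathcal{N}(0,I)}[f(x+\sigma u)u]=\mathbb{E}_{u\sim\mathcal{N}(0,I)}\big[\nabla f(x+\sigma u)\cdot\mathbf{1}_{D_\sigma}(u)\big],$$ where $D_\sigma=\{u\in\mathbb{R}^d: f\text{ is differentiable at }x+\sigma u\}$. (ii) For every $\delta>0$ and $\varepsilon>0$, the number $\bar\sigma$ below is positive and $$\nabla f_\sigma(x)\in\partial_G^\delta f(x)+(1+\|x\|^m)\,\varepsilon\cdot\mathbb{B}\qquad\forall\,\sigma\in(0,\bar\sigma],\ \forall\,x\in\mathbb{R}^d,$$ where $$\bar\sigma=\min\Big\{\Big[\frac{\varepsilon}{2^{m+1}R_1(m+d)^{m/2}}\Big]^{1/m},\,1,\,\frac{\delta}{H}\Big\},\qquad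 H=\Big[-d\cdot W_{-1}\Big(-\frac{\eta_1^{2/d}}{2\pi e}\Big)\Big]^{1/2},$$ $$\eta_1=\min\big\{\varepsilon\,\mathcal{P}^{-1},\,(2\pi)^{d/2}-0.5\big\},\qquad \mathcal{P}=4R_2+2^{m+1}R_1(m+d)^{m/2},$$ and for $m=0$ (so $R_1=0$) the first entry of the minimum defining $\bar\sigma$ is read as $+\infty$, i.e. omitted. -/

import Mathlib

open MeasureTheory ProbabilityTheory
open scoped Topology Pointwise

noncomputable section

namespace GaussSmooth

/-- The Clarke directional derivative `f°(x; v)`, i.e. the upper limit of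
`(f (x' + t v) - f x') / t` as `x' → x` and `t ↓ 0`. -/
def clarkeDeriv {d : ℕ} (f : EuclideanSpace ℝ (Fin d) → ℝ)
    (x v : EuclideanSpace ℝ (Fin d)) : ℝ :=
  Filter.limsup
    (fun p : EuclideanSpace ℝ (Fin d) × ℝ => (f (p.1 + p.2 • v) - f p.1) / p.2)
    (𝓝 x ×ˢ 𝓝[>] (0 : ℝ))

/-- The Clarke subdifferential `∂_C f(x)`. -/
def clarkeSubdiff {d : ℕ} (f : EuclideanSpace ℝ (Fin d) → ℝ)
    (x : EuclideanSpace ℝ (Fin d)) : Set (EuclideanSpace ℝ (Fin d)) :=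
  {s | ∀ v, inner ℝ s v ≤ clarkeDeriv f x v}

/-- The Goldstein `δ`-subdifferential `∂_G^δ f(x)`. -/
def goldsteinSubdiff {d : ℕ} (f : EuclideanSpace ℝ (Fin d) → ℝ) (δ : ℝ)
    (x : EuclideanSpace ℝ (Fin d)) : Set (EuclideanSpace ℝ (Fin d)) :=
  convexHull ℝ (⋃ y ∈ Metric.closedBall x δ, clarkeSubdiff f y)

/-- `f` is locally Lipschitz and subdifferentially polynomially bounded, with parameters
`R₁`, `R₂`, `m`. -/
structure IsSPBWith {d : ℕ} (f : EuclideanSpace ℝ (Fin d) → ℝ) (R₁ R₂ : ℝ) (m : ℕ) : Prop where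
  locallyLipschitz : LocallyLipschitz f
  nonneg_R₁ : 0 ≤ R₁
  pos_R₂ : 0 < R₂
  R₁_eq_zero_iff : R₁ = 0 ↔ m = 0
  bound : ∀ x, ∀ ζ ∈ clarkeSubdiff f x, ‖ζ‖ ≤ R₁ * ‖x‖ ^ m + R₂

/-- The Gaussian smoothing `f_σ(x) = E[f(x + σ u)]`, `u` standard normal. -/
def gaussianSmoothing {d : ℕ} (f : EuclideanSpace ℝ (Fin d) → ℝ) (σ : ℝ)
    (x : EuclideanSpace ℝ (Fin d)) : ℝ :=
  ∫ u, f (x + σ • u) ∂(stdGaussian (EuclideanSpace ℝ (Fin d)))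

open Classical in
/-- The branch `W₋₁` of the Lambert function: the inverse of `t ↦ t eᵗ` from `(-∞, -1]` onto
`[-1/e, 0)`; by convention `0` outside `[-1/e, 0)`. -/
def lambertWNegOne (y : ℝ) : ℝ :=
  if -(1 / Real.exp 1) ≤ y ∧ y < 0 then
    Function.invFunOn (fun t : ℝ => t * Real.exp t) (Set.Iic (-1)) y
  else 0

/-- `𝒫 = 4 R₂ + 2^(m+1) R₁ (m+d)^(m/2)`. -/
def constP (d : ℕ) (R₁ R₂ : ℝ) (m : ℕ) : ℝ :=
  4 * R₂ + 2 ^ (m + 1) * R₁ * ((m : ℝ) + (d : ℝ)) ^ ((m : ℝ) / 2)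

/-- `η₁ = min {ε / 𝒫, (2π)^(d/2) - 0.5}`. -/
def constEta (d : ℕ) (R₁ R₂ : ℝ) (m : ℕ) (ε : ℝ) : ℝ :=
  min (ε / constP d R₁ R₂ m) ((2 * Real.pi) ^ ((d : ℝ) / 2) - 1 / 2)

/-- `H = [-d W₋₁(-η₁^(2/d) / (2πe))]^(1/2)`. -/
def constH (d : ℕ) (R₁ R₂ : ℝ) (m : ℕ) (ε : ℝ) : ℝ :=
  Real.sqrt (-((d : ℝ) * lambertWNegOne
    (-(constEta d R₁ R₂ m ε ^ (2 / (d : ℝ)) / (2 * Real.pi * Real.exp 1)))))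

/-- The threshold `σ̄ = min {[ε / (2^(m+1) R₁ (m+d)^(m/2))]^(1/m), 1, δ/H}`.
When `m = 0` (so `R₁ = 0`) the first entry is read as `+∞`. -/
def sigmaBar (d : ℕ) (R₁ R₂ : ℝ) (m : ℕ) (δ ε : ℝ) : ℝ :=
  if m = 0 then min 1 (δ / constH d R₁ R₂ m ε)
  else
    min ((ε / (2 ^ (m + 1) * R₁ * ((m : ℝ) + (d : ℝ)) ^ ((m : ℝ) / 2))) ^ (1 / (m : ℝ)))
      (min 1 (δ / constH d R₁ R₂ m ε))

end GaussSmooth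

end

/-!
Clarke's directional derivative `f°(x; ·)` of a locally Lipschitz function is sublinear, so by
Hahn–Banach it is the support function of `∂_C f(x)` (`exists_mem_clarkeSubdiff_inner_eq`). The
polynomial bound on the subgradients is therefore a bound on the upper Dini derivatives of `f`
along segments, and hence on the Lipschitz constants of `f` on balls (`IsSPBWith.abs_sub_le`); in
particular `f` grows at most exponentially, and all Gaussian expectations exist.

The gradient of the smoothing is computed twice. The Lipschitz bounds and Rademacher's theorem
allow differentiation of `E[f(x + σ u)]` under the integral sign, which gives `E[∇f(x + σ u)]`. The
Cameron–Martin formula (`integral_add_stdGaussian`) moves the dependence on `x` along a line to the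
density, and differentiation of the density gives `σ⁻¹ E[f(x + σ u) u]`.

For the Goldstein inclusion, let `A` be the ball of radius `H`, which is the radius at which
Chernoff's bound for `P(Aᶜ)` equals `η₁ / (2π)^(d/2)`. Since `σ H ≤ δ`, the conditional mean of
`∇f(x + σ u)` given `A` is in the closure of `∂_G^δ f(x)`. By the growth bound on `∇f` and
`E‖u‖^m ≤ (m + d)^(m/2)`, conditioning on `A` moves the mean by strictly less than `(1 + ‖x‖^m) ε`
(`norm_integral_sub_setAverage_le`), so the closure can be dropped. This requires `P(A) ≥ 1/2`,
which holds when `ε < 𝒫`; when `ε ≥ 𝒫`, the mean and any subgradient at `x` are so small compared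
with `(1 + ‖x‖^m) ε` that their norms can simply be added.
-/

/-! ### The Clarke subdifferential of a locally Lipschitz function -/

namespace GaussSmooth

variable {d : ℕ} {f : EuclideanSpace ℝ (Fin d) → ℝ} {x v : EuclideanSpace ℝ (Fin d)}

theorem tendsto_add_smul_nhds_prod (x v : EuclideanSpace ℝ (Fin d)) :
    Filter.Tendsto (fun p : EuclideanSpace ℝ (Fin d) × ℝ => p.1 + p.2 • v)
      (𝓝 x ×ˢ 𝓝[>] (0 : ℝ)) (𝓝 x) := by
  have h : Continuous fun p : EuclideanSpace ℝ (Fin d) × ℝ => p.1 + p.2 • v := by fun_prop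
  have h' := h.tendsto (x, 0)
  rw [zero_smul, add_zero, nhds_prod_eq] at h'
  exact h'.mono_left (Filter.prod_mono le_rfl nhdsWithin_le_nhds)

theorem eventually_pos_snd (x : EuclideanSpace ℝ (Fin d)) :
    ∀ᶠ p : EuclideanSpace ℝ (Fin d) × ℝ in 𝓝 x ×ˢ 𝓝[>] (0 : ℝ), 0 < p.2 :=
  Filter.tendsto_snd.eventually self_mem_nhdsWithin

/-- The difference quotients are bounded near `x`, so that the real-valued upper limit defining the
Clarke directional derivative is not a junk value. -/
theorem eventually_abs_quotient_le (hf : LocallyLipschitz f) (x v : EuclideanSpace ℝ (Fin d)) :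
    ∃ K : ℝ, ∀ᶠ p : EuclideanSpace ℝ (Fin d) × ℝ in 𝓝 x ×ˢ 𝓝[>] (0 : ℝ),
      |(f (p.1 + p.2 • v) - f p.1) / p.2| ≤ K := by
  obtain ⟨K, t, ht, hK⟩ := hf x
  refine ⟨K * ‖v‖, ?_⟩
  filter_upwards [(tendsto_add_smul_nhds_prod x v).eventually ht,
    Filter.tendsto_fst.eventually ht, eventually_pos_snd x] with p h1 h2 h3
  have := hK.dist_le_mul _ h1 _ h2
  rw [dist_eq_norm, dist_eq_norm, add_sub_cancel_left, norm_smul, Real.norm_eq_abs,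
    Real.norm_eq_abs, abs_of_pos h3] at this
  rw [abs_div, abs_of_pos h3, div_le_iff₀ h3]
  linarith

theorem eventually_lt_of_clarkeDeriv_lt (hf : LocallyLipschitz f) {c : ℝ}
    (hc : clarkeDeriv f x v < c) :
    ∀ᶠ p : EuclideanSpace ℝ (Fin d) × ℝ in 𝓝 x ×ˢ 𝓝[>] (0 : ℝ),
      (f (p.1 + p.2 • v) - f p.1) / p.2 < c := by
  obtain ⟨K, hK⟩ := eventually_abs_quotient_le hf x v
  exact Filter.eventually_lt_of_limsup_lt hc
    (Filter.isBoundedUnder_of_eventually_le (hK.mono fun p hp => (abs_le.1 hp).2))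

theorem clarkeDeriv_le_of_eventually_le (hf : LocallyLipschitz f) {c : ℝ}
    (hc : ∀ᶠ p : EuclideanSpace ℝ (Fin d) × ℝ in 𝓝 x ×ˢ 𝓝[>] (0 : ℝ),
      (f (p.1 + p.2 • v) - f p.1) / p.2 ≤ c) : clarkeDeriv f x v ≤ c := by
  obtain ⟨K, hK⟩ := eventually_abs_quotient_le hf x v
  exact Filter.limsup_le_of_le (Filter.IsCoboundedUnder.of_frequently_ge
    (hK.mono fun p hp => (abs_le.1 hp).1).frequently) hc

theorem clarkeDeriv_add_le (hf : LocallyLipschitz f) (x v w : EuclideanSpace ℝ (Fin d)) :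
    clarkeDeriv f x (v + w) ≤ clarkeDeriv f x v + clarkeDeriv f x w := by
  refine le_of_forall_pos_le_add fun ε hε => ?_
  refine clarkeDeriv_le_of_eventually_le hf ?_
  have h1 := eventually_lt_of_clarkeDeriv_lt hf
    (show clarkeDeriv f x v < clarkeDeriv f x v + ε / 2 by linarith)
  have h2 := eventually_lt_of_clarkeDeriv_lt hf
    (show clarkeDeriv f x w < clarkeDeriv f x w + ε / 2 by linarith)
  have ht : Filter.Tendsto (fun p : EuclideanSpace ℝ (Fin d) × ℝ => (p.1 + p.2 • w, p.2))
      (𝓝 x ×ˢ 𝓝[>] (0 : ℝ)) (𝓝 x ×ˢ 𝓝[>] (0 : ℝ)) :=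
    (tendsto_add_smul_nhds_prod x w).prodMk Filter.tendsto_snd
  filter_upwards [ht.eventually h1, h2] with p hp1 hp2
  have : (f (p.1 + p.2 • (v + w)) - f p.1) / p.2 =
      (f (p.1 + p.2 • w + p.2 • v) - f (p.1 + p.2 • w)) / p.2 +
        (f (p.1 + p.2 • w) - f p.1) / p.2 := by
    rw [show p.1 + p.2 • (v + w) = p.1 + p.2 • w + p.2 • v by rw [smul_add]; abel]
    ring
  rw [this]
  linarith

theorem clarkeDeriv_smul_le (hf : LocallyLipschitz f) {c : ℝ} (hc : 0 < c)
    (x v : EuclideanSpace ℝ (Fin d)) :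
    clarkeDeriv f x (c • v) ≤ c * clarkeDeriv f x v := by
  refine le_of_forall_pos_le_add fun ε hε => clarkeDeriv_le_of_eventually_le hf ?_
  have h1 := eventually_lt_of_clarkeDeriv_lt hf
    (show clarkeDeriv f x v < clarkeDeriv f x v + ε / c by linarith [div_pos hε hc])
  have hs : Filter.Tendsto (fun t : ℝ => t * c) (𝓝[>] 0) (𝓝[>] 0) := by
    refine tendsto_nhdsWithin_iff.2 ⟨?_, ?_⟩
    · have : Filter.Tendsto (fun t : ℝ => t * c) (𝓝 0) (𝓝 (0 * c)) :=
        (continuous_mul_const c).tendsto 0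
      rw [zero_mul] at this
      exact this.mono_left nhdsWithin_le_nhds
    · filter_upwards [self_mem_nhdsWithin] with t ht using mul_pos ht hc
  have ht : Filter.Tendsto (fun p : EuclideanSpace ℝ (Fin d) × ℝ => (p.1, p.2 * c))
      (𝓝 x ×ˢ 𝓝[>] (0 : ℝ)) (𝓝 x ×ˢ 𝓝[>] (0 : ℝ)) :=
    Filter.tendsto_fst.prodMk (hs.comp Filter.tendsto_snd)
  filter_upwards [ht.eventually h1, eventually_pos_snd x] with p hp h0
  rw [← smul_smul, div_lt_iff₀ (mul_pos h0 hc)] at hp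
  rw [div_le_iff₀ h0]
  calc _ ≤ _ := hp.le
    _ = _ := by field_simp

theorem clarkeDeriv_smul (hf : LocallyLipschitz f) {c : ℝ} (hc : 0 < c)
    (x v : EuclideanSpace ℝ (Fin d)) :
    clarkeDeriv f x (c • v) = c * clarkeDeriv f x v := by
  refine le_antisymm (clarkeDeriv_smul_le hf hc x v) ?_
  have := clarkeDeriv_smul_le hf (inv_pos.2 hc) x (c • v)
  rwa [inv_smul_smul₀ hc.ne', ← div_eq_inv_mul, le_div_iff₀' hc] at this

/-- The Clarke directional derivative is the support function of the Clarke subdifferential, with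
the supremum attained: Hahn–Banach for the sublinear function `f°(x; ·)`. -/
theorem exists_mem_clarkeSubdiff_inner_eq (hf : LocallyLipschitz f)
    (x v : EuclideanSpace ℝ (Fin d)) :
    ∃ ζ ∈ clarkeSubdiff f x, inner ℝ ζ v = clarkeDeriv f x v := by
  have hadd := clarkeDeriv_add_le hf x
  have hsmul : ∀ c : ℝ, 0 < c → ∀ v, clarkeDeriv f x (c • v) = c * clarkeDeriv f x v :=
    fun c hc v => clarkeDeriv_smul hf hc x v
  have h0 : clarkeDeriv f x 0 = 0 := by
    have := hsmul 2 two_pos 0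
    rw [smul_zero] at this
    linarith
  have key : ∃ g : EuclideanSpace ℝ (Fin d) →ₗ[ℝ] ℝ,
      g v = clarkeDeriv f x v ∧ ∀ y, g y ≤ clarkeDeriv f x y := by
    rcases eq_or_ne v 0 with rfl | hv
    · obtain ⟨g, -, hg⟩ := exists_extension_of_le_sublinear
        (⊥ : EuclideanSpace ℝ (Fin d) →ₗ.[ℝ] ℝ) (clarkeDeriv f x) hsmul hadd (by
          rintro ⟨y, hy⟩
          obtain rfl : y = 0 := (Submodule.mem_bot ℝ).1 hy
          rw [h0]
          exact (LinearPMap.map_zero _).le)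
      exact ⟨g, by rw [map_zero, h0], hg⟩
    · obtain ⟨g, hg1, hg⟩ := exists_extension_of_le_sublinear
        (LinearPMap.mkSpanSingleton (K := ℝ) v (clarkeDeriv f x v) hv)
        (clarkeDeriv f x) hsmul hadd (by
          rintro ⟨y, hy⟩
          obtain ⟨c, rfl⟩ := Submodule.mem_span_singleton.1 hy
          rw [show LinearPMap.mkSpanSingleton v (clarkeDeriv f x v) hv ⟨c • v, hy⟩ =
            c • clarkeDeriv f x v from LinearPMap.mkSpanSingleton'_apply _ _ _ c hy, smul_eq_mul]
          rcases lt_trichotomy c 0 with hc | rfl | hc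
          · have h1 := hsmul (-c) (neg_pos.2 hc) v
            have h2 := hadd (c • v) ((-c) • v)
            rw [← add_smul, add_neg_cancel, zero_smul, h0] at h2
            dsimp only
            linarith
          · simp [h0]
          · exact (hsmul c hc v).ge)
      refine ⟨g, ?_, hg⟩
      have := hg1 ⟨v, Submodule.mem_span_singleton_self v⟩
      exact this.trans (LinearPMap.mkSpanSingleton_apply ℝ ℝ hv _)
  obtain ⟨g, hg, hle⟩ := key
  refine ⟨(InnerProductSpace.toDual ℝ _).symm (LinearMap.toContinuousLinearMap g),
    fun y => ?_, ?_⟩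
  · rw [InnerProductSpace.toDual_symm_apply]
    exact hle y
  · rw [InnerProductSpace.toDual_symm_apply]
    exact hg

theorem clarkeSubdiff_nonempty (hf : LocallyLipschitz f) (x : EuclideanSpace ℝ (Fin d)) :
    (clarkeSubdiff f x).Nonempty :=
  let ⟨ζ, hζ, _⟩ := exists_mem_clarkeSubdiff_inner_eq hf x 0
  ⟨ζ, hζ⟩

theorem clarkeDeriv_le_mul_norm (hf : LocallyLipschitz f) {B : ℝ}
    (hB : ∀ ζ ∈ clarkeSubdiff f x, ‖ζ‖ ≤ B) (v : EuclideanSpace ℝ (Fin d)) :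
    clarkeDeriv f x v ≤ B * ‖v‖ := by
  obtain ⟨ζ, hζ, h⟩ := exists_mem_clarkeSubdiff_inner_eq hf x v
  rw [← h]
  exact (real_inner_le_norm ζ v).trans (mul_le_mul_of_nonneg_right (hB ζ hζ) (norm_nonneg v))

/-- A one-sided mean value inequality: along the segment from `x` to `y` the upper right Dini
derivative of `f` is at most the Clarke directional derivative. -/
theorem sub_le_of_clarkeSubdiff_bound (hf : LocallyLipschitz f) {B : ℝ}
    {x y : EuclideanSpace ℝ (Fin d)}
    (hB : ∀ z ∈ segment ℝ x y, ∀ ζ ∈ clarkeSubdiff f z, ‖ζ‖ ≤ B) :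
    f y - f x ≤ B * ‖y - x‖ := by
  set v := y - x with hv
  have hcont : Continuous fun t : ℝ => f (x + t • v) := hf.continuous.comp (by fun_prop)
  have key := image_le_of_liminf_slope_right_le_deriv_boundary
    (f := fun t : ℝ => f (x + t • v)) (a := 0) (b := 1) hcont.continuousOn
    (B := fun t => f x + t * (B * ‖v‖)) (B' := fun _ => B * ‖v‖) (by simp) (by fun_prop)
    (fun t _ => by
      have := ((hasDerivAt_id t).mul_const (B * ‖v‖)).const_add (f x)
      simpa using this.hasDerivWithinAt)
    (fun t ht r hr => by
      have hz : x + t • v ∈ segment ℝ x y := by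
        rw [segment_eq_image']
        exact ⟨t, ⟨ht.1, ht.2.le⟩, rfl⟩
      have h1 := eventually_lt_of_clarkeDeriv_lt hf
        ((clarkeDeriv_le_mul_norm hf (hB _ hz) v).trans_lt hr)
      have hs : Filter.Tendsto (fun s : ℝ => (x + t • v, s - t)) (𝓝[>] t)
          (𝓝 (x + t • v) ×ˢ 𝓝[>] (0 : ℝ)) := by
        refine tendsto_const_nhds.prodMk (tendsto_nhdsWithin_iff.2 ⟨?_, ?_⟩)
        · have : Filter.Tendsto (fun s : ℝ => s - t) (𝓝 t) (𝓝 (t - t)) :=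
            (continuous_sub_right t).tendsto t
          rw [sub_self] at this
          exact this.mono_left nhdsWithin_le_nhds
        · filter_upwards [self_mem_nhdsWithin] with s hs using sub_pos.2 (Set.mem_Ioi.1 hs)
      refine Filter.Eventually.frequently ?_
      filter_upwards [hs.eventually h1] with s hs
      rw [slope_def_field]
      rwa [add_assoc, ← add_smul, add_sub_cancel] at hs)
  have := key (Set.right_mem_Icc.2 zero_le_one)
  simp only [one_smul, one_mul] at this
  rw [hv, add_sub_cancel] at this
  linarith

theorem gradient_mem_clarkeSubdiff (hf : LocallyLipschitz f) (hx : DifferentiableAt ℝ f x) :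
    gradient f x ∈ clarkeSubdiff f x := by
  intro v
  refine le_of_forall_gt_imp_ge_of_dense fun c hc => ?_
  have h1 := eventually_lt_of_clarkeDeriv_lt hf hc
  have hs : Filter.Tendsto (fun s : ℝ => (x, s)) (𝓝[>] 0) (𝓝 x ×ˢ 𝓝[>] (0 : ℝ)) :=
    tendsto_const_nhds.prodMk Filter.tendsto_id
  have hlim : Filter.Tendsto (fun s : ℝ => (f (x + s • v) - f x) / s) (𝓝[>] 0)
      (𝓝 (inner ℝ (gradient f x) v)) := by
    have h2 : HasDerivAt (fun s : ℝ => f (x + s • v)) (fderiv ℝ f x v) 0 := by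
      have h3 := hx.hasFDerivAt.hasLineDerivAt v
      exact h3
    rw [gradient, InnerProductSpace.toDual_symm_apply]
    have h4 := (hasDerivAt_iff_tendsto_slope.1 h2).mono_left
      (nhdsWithin_mono 0 (fun s (hs : 0 < s) => hs.ne'))
    refine h4.congr fun s => ?_
    rw [slope_def_field]
    simp
  exact le_of_tendsto hlim ((hs.eventually h1).mono fun s hs => hs.le)

end GaussSmooth

/-! ### The standard Gaussian measure: density, moments, tail, translation -/

namespace GaussSmooth

section Gaussian

variable {E : Type*} [NormedAddCommGroup E] [InnerProductSpace ℝ E]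

/-- The density of the standard Gaussian measure with respect to the volume. -/
noncomputable def stdGaussianDensity (u : E) : ℝ :=
  (2 * Real.pi) ^ (-(Module.finrank ℝ E : ℝ) / 2) * Real.exp (-(1 / 2) * ‖u‖ ^ 2)

theorem stdGaussianDensity_nonneg (u : E) : 0 ≤ stdGaussianDensity u := by
  unfold stdGaussianDensity
  positivity

theorem continuous_stdGaussianDensity : Continuous (stdGaussianDensity : E → ℝ) := by
  unfold stdGaussianDensity
  fun_prop

theorem stdGaussianDensity_smul_exp (c : ℝ) (u : E) :
    stdGaussianDensity u • Real.exp (c * ‖u‖ ^ 2) =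
      (2 * Real.pi) ^ (-(Module.finrank ℝ E : ℝ) / 2) *
        Real.exp (-(1 / 2 - c) * ‖u‖ ^ 2) := by
  rw [stdGaussianDensity, smul_eq_mul, mul_assoc, ← Real.exp_add]
  congr 2
  ring

variable [FiniteDimensional ℝ E] [MeasurableSpace E] [BorelSpace E]

theorem integrable_exp_neg_mul_sq_norm {b : ℝ} (hb : 0 < b) :
    Integrable fun u : E => Real.exp (-b * ‖u‖ ^ 2) := by
  have h := GaussianFourier.integrable_cexp_neg_mul_sq_norm_add (V := E) (b := (b : ℂ))
    (by simpa using hb) 0 0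
  refine h.norm.congr (Filter.Eventually.of_forall fun u => ?_)
  simp [Complex.norm_exp, ← Complex.ofReal_pow]

theorem stdGaussian_eq_withDensity :
    stdGaussian E = volume.withDensity fun u : E => ENNReal.ofReal (stdGaussianDensity u) := by
  have hint : Integrable (stdGaussianDensity : E → ℝ) :=
    (integrable_exp_neg_mul_sq_norm (by norm_num)).const_mul _
  have := isFiniteMeasure_withDensity_ofReal hint.hasFiniteIntegral
  refine Measure.ext_of_charFun (funext fun t => ?_)
  rw [charFun_stdGaussian, charFun_apply, integral_withDensity_eq_integral_toReal_smul
    continuous_stdGaussianDensity.measurable.ennreal_ofReal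
    (Filter.Eventually.of_forall fun _ => ENNReal.ofReal_lt_top)]
  have h := GaussianFourier.integral_cexp_neg_mul_sq_norm_add (V := E) (b := (1 / 2 : ℂ))
    (by norm_num) Complex.I t
  have hpos : (0 : ℝ) ≤ 2 * Real.pi := by positivity
  have hone : (((2 * Real.pi) ^ (-(Module.finrank ℝ E : ℝ) / 2) : ℝ) : ℂ) *
      (Real.pi / (1 / 2 : ℂ)) ^ (Module.finrank ℝ E / 2 : ℂ) = 1 := by
    have : ((Real.pi / (1 / 2 : ℂ)) ^ (Module.finrank ℝ E / 2 : ℂ)) =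
        (((2 * Real.pi) ^ ((Module.finrank ℝ E : ℝ) / 2) : ℝ) : ℂ) := by
      rw [Complex.ofReal_cpow hpos]
      push_cast
      congr 1
      ring
    rw [this, ← Complex.ofReal_mul, ← Real.rpow_add (by positivity)]
    simp [neg_div]
  calc Complex.exp (-‖t‖ ^ 2 / 2)
      = (((2 * Real.pi) ^ (-(Module.finrank ℝ E : ℝ) / 2) : ℝ) : ℂ) *
          ∫ v : E, Complex.exp (-(1 / 2) * ‖v‖ ^ 2 + Complex.I * inner ℝ t v) := by
        rw [h, ← mul_assoc, hone, one_mul, Complex.I_sq]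
        congr 1
        ring
    _ = _ := by
        rw [← integral_const_mul]
        refine integral_congr_ae (Filter.Eventually.of_forall fun v => ?_)
        dsimp only
        rw [ENNReal.toReal_ofReal (stdGaussianDensity_nonneg v), stdGaussianDensity,
          Complex.real_smul, Complex.exp_add, real_inner_comm]
        push_cast
        rw [mul_assoc, mul_comm Complex.I]

theorem integral_stdGaussian_eq {F : Type*} [NormedAddCommGroup F] [NormedSpace ℝ F] (g : E → F) :
    ∫ u, g u ∂(stdGaussian E) = ∫ u, stdGaussianDensity u • g u := by
  rw [stdGaussian_eq_withDensity, integral_withDensity_eq_integral_toReal_smul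
    continuous_stdGaussianDensity.measurable.ennreal_ofReal
    (Filter.Eventually.of_forall fun _ => ENNReal.ofReal_lt_top)]
  simp_rw [ENNReal.toReal_ofReal (stdGaussianDensity_nonneg _)]

theorem integrable_stdGaussian_iff {F : Type*} [NormedAddCommGroup F] [NormedSpace ℝ F]
    {g : E → F} :
    Integrable g (stdGaussian E) ↔ Integrable fun u => stdGaussianDensity u • g u := by
  rw [stdGaussian_eq_withDensity, integrable_withDensity_iff_integrable_smul'
    continuous_stdGaussianDensity.measurable.ennreal_ofReal
    (Filter.Eventually.of_forall fun _ => ENNReal.ofReal_lt_top)]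
  simp_rw [ENNReal.toReal_ofReal (stdGaussianDensity_nonneg _)]

theorem stdGaussian_absolutelyContinuous : stdGaussian E ≪ volume := by
  rw [stdGaussian_eq_withDensity]
  exact withDensity_absolutelyContinuous _ _

theorem integrable_exp_mul_sq_norm {c : ℝ} (hc : c < 1 / 2) :
    Integrable (fun u : E => Real.exp (c * ‖u‖ ^ 2)) (stdGaussian E) := by
  rw [integrable_stdGaussian_iff]
  simp_rw [stdGaussianDensity_smul_exp]
  exact (integrable_exp_neg_mul_sq_norm (by linarith)).const_mul _

theorem integral_exp_mul_sq_norm {c : ℝ} (hc : c < 1 / 2) :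
    ∫ u : E, Real.exp (c * ‖u‖ ^ 2) ∂(stdGaussian E) =
      (1 - 2 * c) ^ (-(Module.finrank ℝ E : ℝ) / 2) := by
  have h1 : 0 < 1 - 2 * c := by linarith
  have hpi := Real.pi_pos
  rw [integral_stdGaussian_eq]
  simp_rw [stdGaussianDensity_smul_exp]
  rw [integral_const_mul, GaussianFourier.integral_rexp_neg_mul_sq_norm (by linarith),
    show Real.pi / (1 / 2 - c) = (2 * Real.pi) * (1 - 2 * c)⁻¹ by
      rw [← div_eq_mul_inv, div_eq_div_iff (by linarith) h1.ne']; ring,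
    Real.mul_rpow (x := 2 * Real.pi) (by positivity) (by positivity), ← mul_assoc, ← Real.rpow_add (by positivity),
    Real.inv_rpow h1.le, ← Real.rpow_neg h1.le, neg_div, neg_add_cancel, Real.rpow_zero, one_mul]

theorem integrable_exp_mul_norm (c : ℝ) :
    Integrable (fun u : E => Real.exp (c * ‖u‖)) (stdGaussian E) := by
  refine Integrable.mono' ((integrable_exp_mul_sq_norm (c := 1 / 4) (by norm_num)).mul_const
    (Real.exp (c ^ 2))) (by fun_prop) (Filter.Eventually.of_forall fun u => ?_)
  rw [Real.norm_eq_abs, abs_of_pos (Real.exp_pos _), ← Real.exp_add]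
  refine Real.exp_le_exp.2 ?_
  nlinarith [sq_nonneg (‖u‖ / 2 - c)]

/-- A measurable function of at most exponential growth is integrable for the Gaussian measure. -/
theorem integrable_of_norm_le_exp {F : Type*} [NormedAddCommGroup F] {g : E → F}
    (hg : AEStronglyMeasurable g (stdGaussian E)) {C c : ℝ}
    (h : ∀ u, ‖g u‖ ≤ C * Real.exp (c * ‖u‖)) : Integrable g (stdGaussian E) :=
  Integrable.mono' ((integrable_exp_mul_norm c).const_mul C) hg (Filter.Eventually.of_forall h)

/-- The Cameron–Martin formula for the standard Gaussian measure. -/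
theorem integral_add_stdGaussian {F : Type*} [NormedAddCommGroup F] [NormedSpace ℝ F]
    (g : E → F) (h : E) :
    ∫ u, g (u + h) ∂(stdGaussian E) =
      ∫ u, Real.exp (inner ℝ h u - ‖h‖ ^ 2 / 2) • g u ∂(stdGaussian E) := by
  rw [integral_stdGaussian_eq, integral_stdGaussian_eq,
    ← integral_sub_right_eq_self (fun u => stdGaussianDensity u • g (u + h)) h]
  refine integral_congr_ae (Filter.Eventually.of_forall fun u => ?_)
  dsimp only
  rw [sub_add_cancel, smul_smul, stdGaussianDensity, stdGaussianDensity, mul_assoc,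
    ← Real.exp_add, norm_sub_sq_real, real_inner_comm]
  congr 3
  ring

theorem integrable_norm_pow (m : ℕ) :
    Integrable (fun u : E => ‖u‖ ^ m) (stdGaussian E) := by
  refine integrable_of_norm_le_exp (by fun_prop) (C := m.factorial) (c := 1) fun u => ?_
  have := Real.pow_div_factorial_le_exp ‖u‖ (norm_nonneg u) m
  rw [div_le_iff₀ (by positivity)] at this
  rw [norm_pow, norm_norm, one_mul]
  linarith

/-- The bound `E‖u‖^m ≤ (m + n)^(m/2)` in dimension `n`. It comes from `s ≤ exp (s - 1)` at
`s = ‖u‖² / (m + n)`, which is sharp at the typical value of `‖u‖²` under the measure tilted by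
`‖u‖^m`. -/
theorem integral_norm_pow_le (hE : 0 < Module.finrank ℝ E) (m : ℕ) :
    ∫ u : E, ‖u‖ ^ m ∂(stdGaussian E) ≤
      ((m : ℝ) + Module.finrank ℝ E) ^ ((m : ℝ) / 2) := by
  set n : ℝ := (Module.finrank ℝ E : ℝ) with hn
  have hn0 : 0 < n := Nat.cast_pos.2 hE
  have hm : (0 : ℝ) ≤ m := Nat.cast_nonneg m
  have hmn : 0 < m + n := by positivity
  have hpt : ∀ u : E, ‖u‖ ^ m ≤ ((m + n) ^ ((m : ℝ) / 2) * Real.exp (-(m / 2))) *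
      Real.exp (m / (2 * (m + n)) * ‖u‖ ^ 2) := fun u => by
    have h1 : ‖u‖ ^ 2 ≤ (m + n) * Real.exp (‖u‖ ^ 2 / (m + n) - 1) := by
      have := Real.add_one_le_exp (‖u‖ ^ 2 / (m + n) - 1)
      rw [sub_add_cancel, div_le_iff₀ hmn] at this
      linarith
    calc ‖u‖ ^ m = (‖u‖ ^ 2) ^ ((m : ℝ) / 2) := by
          rw [← Real.rpow_natCast, ← Real.rpow_natCast, ← Real.rpow_mul (norm_nonneg u)]
          congr 1
          push_cast
          ring
      _ ≤ ((m + n) * Real.exp (‖u‖ ^ 2 / (m + n) - 1)) ^ ((m : ℝ) / 2) :=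
          Real.rpow_le_rpow (by positivity) h1 (by positivity)
      _ = _ := by
          rw [Real.mul_rpow hmn.le (Real.exp_pos _).le, ← Real.exp_mul, mul_assoc, ← Real.exp_add]
          congr 2
          field_simp
          ring
  have hc : (m : ℝ) / (2 * (m + n)) < 1 / 2 := by
    rw [div_lt_div_iff₀ (by positivity) two_pos]
    linarith
  -- with `c = m / (2 (m + n))` this is `E exp (c ‖u‖²) = (1 + m / n) ^ (n / 2) ≤ exp (m / 2)`
  have h2 : Real.exp (-(m / 2)) * (1 - 2 * ((m : ℝ) / (2 * (m + n)))) ^ (-n / 2) ≤ 1 := by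
    have h3 : 1 - 2 * ((m : ℝ) / (2 * (m + n))) = ((m : ℝ) / n + 1)⁻¹ := by
      field_simp
      ring
    have h4 : (0 : ℝ) < (m : ℝ) / n + 1 := by positivity
    rw [h3, Real.inv_rpow h4.le, ← Real.rpow_neg h4.le, neg_div, neg_neg, Real.exp_neg,
      inv_mul_le_one₀ (Real.exp_pos _)]
    calc ((m : ℝ) / n + 1) ^ (n / 2) ≤ (Real.exp (m / n)) ^ (n / 2) :=
          Real.rpow_le_rpow h4.le (Real.add_one_le_exp _) (by positivity)
      _ = Real.exp (m / 2) := by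
          rw [← Real.exp_mul]
          congr 1
          field_simp
  calc ∫ u : E, ‖u‖ ^ m ∂(stdGaussian E)
      ≤ ∫ u : E, ((m + n) ^ ((m : ℝ) / 2) * Real.exp (-(m / 2))) *
          Real.exp (m / (2 * (m + n)) * ‖u‖ ^ 2) ∂(stdGaussian E) :=
        integral_mono (integrable_norm_pow m) ((integrable_exp_mul_sq_norm hc).const_mul _) hpt
    _ = (m + n) ^ ((m : ℝ) / 2) * (Real.exp (-(m / 2)) *
          (1 - 2 * ((m : ℝ) / (2 * (m + n)))) ^ (-n / 2)) := by
        rw [integral_const_mul, integral_exp_mul_sq_norm hc, mul_assoc]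
    _ ≤ _ := mul_le_of_le_one_right (by positivity) h2

/-- Chernoff's bound for the tail of the norm of a standard Gaussian vector in dimension `n`, at
radius `√(n t)`. -/
theorem stdGaussian_norm_tail_le {t : ℝ} (ht : 1 ≤ t) :
    (stdGaussian E).real {u | Module.finrank ℝ E * t ≤ ‖u‖ ^ 2} ≤
      (t * Real.exp (1 - t)) ^ ((Module.finrank ℝ E : ℝ) / 2) := by
  set n : ℝ := (Module.finrank ℝ E : ℝ) with hn
  have ht0 : 0 < t := by linarith
  -- the optimal exponent in Markov's inequality for `exp (c ‖u‖²)`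
  set c : ℝ := (1 - t⁻¹) / 2 with hc
  have hc0 : 0 ≤ c := by
    have := inv_le_one_of_one_le₀ ht
    rw [hc]
    linarith
  have hc1 : c < 1 / 2 := by
    have : 0 < t⁻¹ := by positivity
    rw [hc]
    linarith
  have hM := mul_meas_ge_le_integral_of_nonneg (μ := stdGaussian E)
    (Filter.Eventually.of_forall fun u : E => (Real.exp_pos (c * ‖u‖ ^ 2)).le)
    (integrable_exp_mul_sq_norm hc1) (Real.exp (c * (n * t)))
  rw [integral_exp_mul_sq_norm hc1, ← hn, show 1 - 2 * c = t⁻¹ by rw [hc]; ring,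
    Real.inv_rpow ht0.le, ← Real.rpow_neg ht0.le, neg_div, neg_neg] at hM
  have hsub : (stdGaussian E).real {u | n * t ≤ ‖u‖ ^ 2} ≤
      (stdGaussian E).real {u | Real.exp (c * (n * t)) ≤ Real.exp (c * ‖u‖ ^ 2)} :=
    measureReal_mono fun u hu => Real.exp_le_exp.2 (mul_le_mul_of_nonneg_left hu hc0)
  refine hsub.trans ?_
  rw [← le_div_iff₀' (Real.exp_pos _)] at hM
  refine hM.trans (le_of_eq ?_)
  rw [Real.mul_rpow ht0.le (Real.exp_pos _).le, ← Real.exp_mul, div_eq_mul_inv, ← Real.exp_neg]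
  congr 2
  rw [hc]
  field_simp
  ring

end Gaussian

end GaussSmooth

/-! ### Growth of `f` and differentiation of its Gaussian smoothing -/

/-- Rademacher's theorem for locally Lipschitz functions. -/
theorem LocallyLipschitz.ae_differentiableAt {E : Type*} [NormedAddCommGroup E] [NormedSpace ℝ E]
    [FiniteDimensional ℝ E] [MeasurableSpace E] [BorelSpace E] {μ : Measure E}
    [μ.IsAddHaarMeasure] {f : E → ℝ} (hf : LocallyLipschitz f) :
    ∀ᵐ x ∂μ, DifferentiableAt ℝ f x := by
  refine measure_null_of_locally_null _ fun x _ => ?_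
  obtain ⟨K, t, ht, hK⟩ := hf x
  refine ⟨_, inter_mem_nhdsWithin _ (interior_mem_nhds.2 ht), ?_⟩
  refine measure_mono_null ?_ hK.ae_differentiableWithinAt_of_mem
  rintro y ⟨hy, hyt⟩ h
  exact hy ((h (interior_subset hyt)).differentiableAt (mem_interior_iff_mem_nhds.1 hyt))

namespace GaussSmooth

variable {d : ℕ} {f : EuclideanSpace ℝ (Fin d) → ℝ} {R₁ R₂ : ℝ} {m : ℕ}

theorem ae_differentiableAt_add_smul (hf : LocallyLipschitz f) {σ : ℝ} (hσ : 0 < σ)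
    (x : EuclideanSpace ℝ (Fin d)) :
    ∀ᵐ u ∂(stdGaussian (EuclideanSpace ℝ (Fin d))), DifferentiableAt ℝ f (x + σ • u) := by
  have haff : LipschitzWith ‖σ‖₊ fun u : EuclideanSpace ℝ (Fin d) => x + σ • u :=
    LipschitzWith.of_dist_le_mul fun u v => by
      rw [dist_add_left, dist_smul₀, coe_nnnorm]
  refine stdGaussian_absolutelyContinuous.ae_le ?_
  filter_upwards [LocallyLipschitz.ae_differentiableAt (μ := volume)
    (hf.comp haff.locallyLipschitz)] with u hu
  have h1 : f = (f ∘ fun u => x + σ • u) ∘ fun y => σ⁻¹ • (y - x) := by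
    ext y
    simp [smul_inv_smul₀ hσ.ne']
  rw [h1]
  refine DifferentiableAt.comp _ ?_ (by fun_prop)
  simpa [inv_smul_smul₀ hσ.ne'] using hu

theorem IsSPBWith.abs_sub_le (hf : IsSPBWith f R₁ R₂ m) {r : ℝ} {x y : EuclideanSpace ℝ (Fin d)}
    (hx : ‖x‖ ≤ r) (hy : ‖y‖ ≤ r) : |f y - f x| ≤ (R₁ * r ^ m + R₂) * ‖y - x‖ := by
  have key : ∀ x y : EuclideanSpace ℝ (Fin d), ‖x‖ ≤ r → ‖y‖ ≤ r →
      f y - f x ≤ (R₁ * r ^ m + R₂) * ‖y - x‖ := fun x y hx hy => by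
    refine sub_le_of_clarkeSubdiff_bound hf.locallyLipschitz fun z hz ζ hζ => ?_
    have hzr : ‖z‖ ≤ r := by
      have := (convex_closedBall (0 : EuclideanSpace ℝ (Fin d)) r).segment_subset
        (mem_closedBall_zero_iff.2 hx) (mem_closedBall_zero_iff.2 hy) hz
      exact mem_closedBall_zero_iff.1 this
    have h1 := hf.nonneg_R₁
    refine (hf.bound z ζ hζ).trans ?_
    gcongr
  refine abs_sub_le_iff.2 ⟨key x y hx hy, ?_⟩
  rw [norm_sub_rev]
  exact key y x hy hx

theorem IsSPBWith.norm_gradient_le (hf : IsSPBWith f R₁ R₂ m) (x : EuclideanSpace ℝ (Fin d)) :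
    ‖gradient f x‖ ≤ R₁ * ‖x‖ ^ m + R₂ := by
  by_cases hx : DifferentiableAt ℝ f x
  · exact hf.bound x _ (gradient_mem_clarkeSubdiff hf.locallyLipschitz hx)
  · have h1 := hf.nonneg_R₁
    have h2 := hf.pos_R₂
    rw [gradient, fderiv_zero_of_not_differentiableAt hx, map_zero, norm_zero]
    positivity

theorem IsSPBWith.growth_le_exp (hf : IsSPBWith f R₁ R₂ m) {r : ℝ} (hr : 0 ≤ r) :
    R₁ * r ^ m + R₂ ≤ (R₁ * m.factorial + R₂) * Real.exp r := by
  have h1 := Real.pow_div_factorial_le_exp r hr m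
  rw [div_le_iff₀ (by positivity)] at h1
  have h2 := mul_le_mul_of_nonneg_left h1 hf.nonneg_R₁
  have h3 := mul_le_mul_of_nonneg_left (Real.one_le_exp hr) hf.pos_R₂.le
  linarith

theorem IsSPBWith.exists_abs_le_exp (hf : IsSPBWith f R₁ R₂ m) :
    ∃ C, 0 ≤ C ∧ ∀ y, |f y| ≤ C * Real.exp (2 * ‖y‖) := by
  have hR1 := hf.nonneg_R₁
  have hR2 := hf.pos_R₂
  refine ⟨|f 0| + (R₁ * m.factorial + R₂), by positivity, fun y => ?_⟩
  have h1 := hf.abs_sub_le (r := ‖y‖) (x := 0) (y := y) (by simp) le_rfl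
  rw [sub_zero] at h1
  have h2 := hf.growth_le_exp (norm_nonneg y)
  have h3 : ‖y‖ ≤ Real.exp ‖y‖ := (le_add_of_nonneg_right zero_le_one).trans (Real.add_one_le_exp _)
  have h4 := mul_le_mul h2 h3 (norm_nonneg y) (by positivity)
  have h5 := Real.one_le_exp (show 0 ≤ 2 * ‖y‖ by positivity)
  have h6 := mul_le_mul_of_nonneg_left h5 (abs_nonneg (f 0))
  have h7 := abs_le.1 h1
  have h8 := neg_abs_le (f 0)
  have h9 := le_abs_self (f 0)
  rw [mul_assoc, ← Real.exp_add, ← two_mul] at h4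
  rw [abs_le]
  constructor <;> linarith [h7.1, h7.2]

theorem norm_add_smul_le {σ : ℝ} (hσ : 0 < σ) (x u : EuclideanSpace ℝ (Fin d)) :
    ‖x + σ • u‖ ≤ ‖x‖ + σ * ‖u‖ := by
  refine (norm_add_le _ _).trans ?_
  rw [norm_smul, Real.norm_eq_abs, abs_of_pos hσ]

theorem IsSPBWith.exists_abs_comp_le_exp (hf : IsSPBWith f R₁ R₂ m) {σ : ℝ} (hσ : 0 < σ)
    (x : EuclideanSpace ℝ (Fin d)) :
    ∃ C, 0 ≤ C ∧ ∀ u, |f (x + σ • u)| ≤ C * Real.exp (2 * σ * ‖u‖) := by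
  obtain ⟨C, hC, h⟩ := hf.exists_abs_le_exp
  refine ⟨C * Real.exp (2 * ‖x‖), by positivity, fun u => (h _).trans ?_⟩
  rw [mul_assoc, ← Real.exp_add]
  refine mul_le_mul_of_nonneg_left (Real.exp_le_exp.2 ?_) hC
  linarith [norm_add_smul_le hσ x u]

theorem IsSPBWith.continuous_comp (hf : IsSPBWith f R₁ R₂ m) (σ : ℝ)
    (x : EuclideanSpace ℝ (Fin d)) : Continuous fun u => f (x + σ • u) :=
  hf.locallyLipschitz.continuous.comp (by fun_prop)

theorem IsSPBWith.integrable_comp (hf : IsSPBWith f R₁ R₂ m) {σ : ℝ} (hσ : 0 < σ)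
    (x : EuclideanSpace ℝ (Fin d)) :
    Integrable (fun u => f (x + σ • u)) (stdGaussian (EuclideanSpace ℝ (Fin d))) := by
  obtain ⟨C, -, h⟩ := hf.exists_abs_comp_le_exp hσ x
  exact integrable_of_norm_le_exp (hf.continuous_comp σ x).aestronglyMeasurable h

theorem IsSPBWith.integrable_comp_smul (hf : IsSPBWith f R₁ R₂ m) {σ : ℝ} (hσ : 0 < σ)
    (x : EuclideanSpace ℝ (Fin d)) :
    Integrable (fun u => f (x + σ • u) • u) (stdGaussian (EuclideanSpace ℝ (Fin d))) := by
  obtain ⟨C, hC, h⟩ := hf.exists_abs_comp_le_exp hσ x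
  refine integrable_of_norm_le_exp
    ((hf.continuous_comp σ x).smul continuous_id).aestronglyMeasurable
    (C := C) (c := 2 * σ + 1) fun u => ?_
  have h3 : ‖u‖ ≤ Real.exp ‖u‖ := (le_add_of_nonneg_right zero_le_one).trans (Real.add_one_le_exp _)
  have h4 := mul_le_mul (h u) h3 (norm_nonneg u) (by positivity)
  rw [mul_assoc, ← Real.exp_add] at h4
  rw [norm_smul, Real.norm_eq_abs, add_mul, one_mul]
  exact h4

theorem IsSPBWith.integrable_gradient (hf : IsSPBWith f R₁ R₂ m) {σ : ℝ} (hσ : 0 < σ)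
    (x : EuclideanSpace ℝ (Fin d)) :
    Integrable (fun u => gradient f (x + σ • u)) (stdGaussian (EuclideanSpace ℝ (Fin d))) := by
  have hR1 := hf.nonneg_R₁
  have hR2 := hf.pos_R₂
  refine integrable_of_norm_le_exp (C := (R₁ * m.factorial + R₂) * Real.exp ‖x‖) (c := σ) ?_
    fun u => ?_
  · have h1 : Measurable fun u : EuclideanSpace ℝ (Fin d) => fderiv ℝ f (x + σ • u) :=
      (measurable_fderiv ℝ f).comp (by fun_prop)
    exact ((InnerProductSpace.toDual ℝ _).symm.continuous.measurable.comp h1).aestronglyMeasurable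
  · refine (hf.norm_gradient_le _).trans ((hf.growth_le_exp (norm_nonneg _)).trans ?_)
    rw [mul_assoc, ← Real.exp_add]
    exact mul_le_mul_of_nonneg_left (Real.exp_le_exp.2 (norm_add_smul_le hσ x u)) (by positivity)

theorem hasFDerivAt_gaussianSmoothing (hf : IsSPBWith f R₁ R₂ m) {σ : ℝ} (hσ : 0 < σ)
    (x : EuclideanSpace ℝ (Fin d)) :
    Integrable (fun u => fderiv ℝ f (x + σ • u)) (stdGaussian (EuclideanSpace ℝ (Fin d))) ∧
    HasFDerivAt (gaussianSmoothing f σ)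
      (∫ u, fderiv ℝ f (x + σ • u) ∂(stdGaussian (EuclideanSpace ℝ (Fin d)))) x := by
  have hR1 := hf.nonneg_R₁
  have hR2 := hf.pos_R₂
  refine hasFDerivAt_integral_of_dominated_loc_of_lip
    (F := fun y u => f (y + σ • u))
    (bound := fun u => ((R₁ * m.factorial + R₂) * Real.exp (‖x‖ + 1)) * Real.exp (σ * ‖u‖))
    (Metric.ball_mem_nhds x one_pos)
    (Filter.Eventually.of_forall fun y => (hf.continuous_comp σ y).aestronglyMeasurable)
    (hf.integrable_comp hσ x)
    (((measurable_fderiv ℝ f).comp (by fun_prop)).aestronglyMeasurable)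
    (Filter.Eventually.of_forall fun u => LipschitzOnWith.of_dist_le_mul fun y hy z hz => ?_)
    ((integrable_exp_mul_norm σ).const_mul _)
    ((ae_differentiableAt_add_smul hf.locallyLipschitz hσ x).mono fun u hu => ?_)
  · have hball : ∀ y ∈ Metric.ball x 1, ‖y + σ • u‖ ≤ ‖x‖ + 1 + σ * ‖u‖ := fun y hy => by
      have h1 : ‖y - x‖ < 1 := mem_ball_iff_norm.1 hy
      have h2 := norm_add_smul_le hσ y u
      have h3 := norm_le_norm_add_norm_sub' y x
      linarith
    have h1 := hf.abs_sub_le (hball z hz) (hball y hy)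
    have h2 := hf.growth_le_exp (show 0 ≤ ‖x‖ + 1 + σ * ‖u‖ by positivity)
    rw [add_sub_add_right_eq_sub] at h1
    rw [Real.dist_eq, dist_eq_norm, Real.coe_nnabs, mul_assoc, ← Real.exp_add]
    exact (h1.trans (mul_le_mul_of_nonneg_right h2 (norm_nonneg _))).trans
      (mul_le_mul_of_nonneg_right (le_abs_self _) (norm_nonneg _))
  · exact (hasFDerivAt_comp_add_right (σ • u)).2 hu.hasFDerivAt

theorem gradient_gaussianSmoothing_eq_integral_gradient (hf : IsSPBWith f R₁ R₂ m) {σ : ℝ}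
    (hσ : 0 < σ) (x : EuclideanSpace ℝ (Fin d)) :
    gradient (gaussianSmoothing f σ) x =
      ∫ u, gradient f (x + σ • u) ∂(stdGaussian (EuclideanSpace ℝ (Fin d))) := by
  obtain ⟨h1, h2⟩ := hasFDerivAt_gaussianSmoothing hf hσ x
  refine ext_inner_left ℝ fun v => ?_
  rw [real_inner_comm, gradient, InnerProductSpace.toDual_symm_apply, h2.fderiv,
    ContinuousLinearMap.integral_apply h1, ← integral_inner (hf.integrable_gradient hσ x)]
  refine integral_congr_ae (Filter.Eventually.of_forall fun u => ?_)
  dsimp only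
  rw [real_inner_comm, gradient, InnerProductSpace.toDual_symm_apply]

/-- Differentiation of the Gaussian smoothing along a line after the Cameron–Martin formula has
moved the dependence on the line's parameter from `f` to the density. -/
theorem hasDerivAt_gaussianSmoothing_line (hf : IsSPBWith f R₁ R₂ m) {σ : ℝ} (hσ : 0 < σ)
    (x v : EuclideanSpace ℝ (Fin d)) :
    HasDerivAt (fun t : ℝ => gaussianSmoothing f σ (x + t • v))
      (∫ u, inner ℝ (σ⁻¹ • v) u * f (x + σ • u) ∂(stdGaussian (EuclideanSpace ℝ (Fin d)))) 0 := by
  set h : EuclideanSpace ℝ (Fin d) := σ⁻¹ • v with hh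
  have heq : ∀ t : ℝ, gaussianSmoothing f σ (x + t • v) =
      ∫ u, Real.exp (t * inner ℝ h u - t ^ 2 * (‖h‖ ^ 2 / 2)) * f (x + σ • u)
        ∂(stdGaussian (EuclideanSpace ℝ (Fin d))) := fun t => by
    have := integral_add_stdGaussian (fun u => f (x + σ • u)) (t • h)
    rw [gaussianSmoothing]
    calc _ = ∫ u, f (x + σ • (u + t • h)) ∂(stdGaussian (EuclideanSpace ℝ (Fin d))) := by
          refine integral_congr_ae (Filter.Eventually.of_forall fun u => ?_)
          dsimp only
          rw [smul_add, smul_comm σ t h, hh, smul_inv_smul₀ hσ.ne', add_assoc, add_comm (t • v)]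
      _ = _ := by
          rw [this]
          refine integral_congr_ae (Filter.Eventually.of_forall fun u => ?_)
          dsimp only
          rw [inner_smul_left, norm_smul, mul_pow, Real.norm_eq_abs, sq_abs, smul_eq_mul,
            mul_div_assoc]
          rfl
  simp_rw [heq]
  obtain ⟨C, hC, hfC⟩ := hf.exists_abs_comp_le_exp hσ x
  have hcont := hf.continuous_comp σ x
  have hinner : Continuous fun u : EuclideanSpace ℝ (Fin d) => inner ℝ h u :=
    continuous_const.inner continuous_id
  have hexp : ∀ t : ℝ, Continuous fun u : EuclideanSpace ℝ (Fin d) =>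
      Real.exp (t * inner ℝ h u - t ^ 2 * (‖h‖ ^ 2 / 2)) := fun t =>
    Real.continuous_exp.comp ((continuous_const.mul hinner).sub continuous_const)
  have key := hasDerivAt_integral_of_dominated_loc_of_deriv_le
    (μ := stdGaussian (EuclideanSpace ℝ (Fin d))) (x₀ := (0 : ℝ))
    (F := fun t u => Real.exp (t * inner ℝ h u - t ^ 2 * (‖h‖ ^ 2 / 2)) * f (x + σ • u))
    (F' := fun t u => Real.exp (t * inner ℝ h u - t ^ 2 * (‖h‖ ^ 2 / 2)) *
      (inner ℝ h u - t * ‖h‖ ^ 2) * f (x + σ • u))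
    (bound := fun u => ((1 + ‖h‖ ^ 2) * C) * Real.exp ((2 * ‖h‖ + 2 * σ) * ‖u‖))
    (Metric.ball_mem_nhds 0 one_pos)
    (Filter.Eventually.of_forall fun t => ((hexp t).mul hcont).aestronglyMeasurable)
    (by simpa using hf.integrable_comp hσ x)
    (((hexp 0).mul (hinner.sub continuous_const)).mul hcont).aestronglyMeasurable
    (Filter.Eventually.of_forall fun u t ht => ?_)
    ((integrable_exp_mul_norm _).const_mul _)
    (Filter.Eventually.of_forall fun u t ht => ?_)
  · simpa using key.2
  · rw [mem_ball_zero_iff, Real.norm_eq_abs] at ht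
    have hi : |inner ℝ h u| ≤ ‖h‖ * ‖u‖ := abs_real_inner_le_norm h u
    have hn : 0 ≤ ‖h‖ * ‖u‖ := by positivity
    have ht1 : |t * inner ℝ h u| ≤ ‖h‖ * ‖u‖ := by
      rw [abs_mul]
      exact (mul_le_of_le_one_left (abs_nonneg _) ht.le).trans hi
    have ht2 : |t * ‖h‖ ^ 2| ≤ ‖h‖ ^ 2 := by
      rw [abs_mul, abs_of_nonneg (sq_nonneg ‖h‖)]
      exact mul_le_of_le_one_left (sq_nonneg _) ht.le
    have h1 : Real.exp (t * inner ℝ h u - t ^ 2 * (‖h‖ ^ 2 / 2)) ≤ Real.exp (‖h‖ * ‖u‖) := by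
      refine Real.exp_le_exp.2 ?_
      have : 0 ≤ t ^ 2 * (‖h‖ ^ 2 / 2) := by positivity
      linarith [le_abs_self (t * inner ℝ h u)]
    have h2 : |inner ℝ h u - t * ‖h‖ ^ 2| ≤ (1 + ‖h‖ ^ 2) * Real.exp (‖h‖ * ‖u‖) := by
      have h3 := Real.add_one_le_exp (‖h‖ * ‖u‖)
      have h4 := mul_le_mul_of_nonneg_left (Real.one_le_exp hn) (sq_nonneg ‖h‖)
      have h5 := abs_sub (inner ℝ h u) (t * ‖h‖ ^ 2)
      linarith
    rw [norm_mul, norm_mul, Real.norm_eq_abs, Real.norm_eq_abs, Real.norm_eq_abs,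
      abs_of_pos (Real.exp_pos _)]
    calc _ ≤ Real.exp (‖h‖ * ‖u‖) * ((1 + ‖h‖ ^ 2) * Real.exp (‖h‖ * ‖u‖)) *
          (C * Real.exp (2 * σ * ‖u‖)) := by
          gcongr
          exact hfC u
      _ = ((1 + ‖h‖ ^ 2) * C) * (Real.exp (‖h‖ * ‖u‖) * Real.exp (‖h‖ * ‖u‖) *
            Real.exp (2 * σ * ‖u‖)) := by ring
      _ = _ := by
          rw [← Real.exp_add, ← Real.exp_add]
          congr 2
          ring
  · have h1 : HasDerivAt (fun t : ℝ => t * inner ℝ h u - t ^ 2 * (‖h‖ ^ 2 / 2))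
        (inner ℝ h u - t * ‖h‖ ^ 2) t := by
      have := ((hasDerivAt_id t).mul_const (inner ℝ h u)).sub
        ((hasDerivAt_pow 2 t).mul_const (‖h‖ ^ 2 / 2))
      convert! this using 1
      norm_num
      ring
    exact h1.exp.mul_const _

theorem gradient_gaussianSmoothing_eq_integral_smul (hf : IsSPBWith f R₁ R₂ m) {σ : ℝ}
    (hσ : 0 < σ) (x : EuclideanSpace ℝ (Fin d)) :
    gradient (gaussianSmoothing f σ) x =
      σ⁻¹ • ∫ u, f (x + σ • u) • u ∂(stdGaussian (EuclideanSpace ℝ (Fin d))) := by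
  obtain ⟨-, h2⟩ := hasFDerivAt_gaussianSmoothing hf hσ x
  refine ext_inner_left ℝ fun v => ?_
  have h3 : HasDerivAt (fun t : ℝ => gaussianSmoothing f σ (x + t • v))
      (fderiv ℝ (gaussianSmoothing f σ) x v) 0 :=
    h2.differentiableAt.hasFDerivAt.hasLineDerivAt v
  rw [real_inner_comm, gradient, InnerProductSpace.toDual_symm_apply,
    h3.unique (hasDerivAt_gaussianSmoothing_line hf hσ x v), inner_smul_right,
    ← integral_inner (hf.integrable_comp_smul hσ x), ← integral_const_mul]
  refine integral_congr_ae (Filter.Eventually.of_forall fun u => ?_)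
  simp only [real_inner_smul_left, real_inner_smul_right]
  ring

/-- The indicator of the set of points of differentiability is redundant, because `gradient` is `0`
elsewhere. -/
theorem indicator_differentiableAt_gradient (f : EuclideanSpace ℝ (Fin d) → ℝ) (σ : ℝ)
    (x : EuclideanSpace ℝ (Fin d)) :
    {u : EuclideanSpace ℝ (Fin d) | DifferentiableAt ℝ f (x + σ • u)}.indicator
      (fun u => gradient f (x + σ • u)) = fun u => gradient f (x + σ • u) := by
  rw [Set.indicator_eq_self]
  intro u hu
  by_contra h
  refine hu ?_
  change gradient f (x + σ • u) = 0
  rw [gradient, fderiv_zero_of_not_differentiableAt h, map_zero]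

end GaussSmooth

/-! ### The constants `η₁`, `H` and `σ̄` -/

namespace GaussSmooth

theorem lambertWNegOne_spec {y : ℝ} (h1 : -(1 / Real.exp 1) ≤ y) (h2 : y < 0) :
    lambertWNegOne y ≤ -1 ∧ lambertWNegOne y * Real.exp (lambertWNegOne y) = y := by
  have hex : ∃ t ∈ Set.Iic (-1 : ℝ), t * Real.exp t = y := by
    have hlim := Real.tendsto_pow_mul_exp_neg_atTop_nhds_zero 1
    obtain ⟨T, hT, hT1⟩ := ((hlim.eventually (gt_mem_nhds (neg_pos.2 h2))).and
      (Filter.eventually_ge_atTop 1)).exists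
    rw [pow_one] at hT
    have hle : -T ≤ -1 := by linarith
    obtain ⟨t, ht, hty⟩ := intermediate_value_Icc' hle
      (f := fun t : ℝ => t * Real.exp t) (by fun_prop)
      (show y ∈ Set.Icc (-1 * Real.exp (-1)) (-T * Real.exp (-T)) by
        refine ⟨?_, by linarith⟩
        rw [Real.exp_neg, neg_one_mul, ← one_div]
        exact h1)
    exact ⟨t, ht.2, hty⟩
  have h : lambertWNegOne y =
      Function.invFunOn (fun t : ℝ => t * Real.exp t) (Set.Iic (-1)) y := if_pos ⟨h1, h2⟩
  rw [h]
  exact ⟨Function.invFunOn_mem hex, Function.invFunOn_eq hex⟩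

theorem two_le_two_pi_rpow {d : ℕ} (hd : 0 < d) : 2 ≤ (2 * Real.pi) ^ ((d : ℝ) / 2) := by
  have hpi := Real.pi_gt_three
  have hd1 : (1 : ℝ) ≤ d := Nat.one_le_cast.2 hd
  calc (2 : ℝ) = (2 ^ 2) ^ ((1 : ℝ) / 2) := by
        rw [← Real.sqrt_eq_rpow, Real.sqrt_sq two_pos.le]
    _ ≤ (2 * Real.pi) ^ ((1 : ℝ) / 2) :=
        Real.rpow_le_rpow (by norm_num) (by linarith) (by norm_num)
    _ ≤ _ := Real.rpow_le_rpow_of_exponent_le (by linarith) (by linarith)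

variable {d : ℕ} {R₁ R₂ ε δ : ℝ} {m : ℕ}

theorem constP_pos (hR₁ : 0 ≤ R₁) (hR₂ : 0 < R₂) : 0 < constP d R₁ R₂ m := by
  unfold constP
  positivity

theorem constEta_pos (hd : 0 < d) (hR₁ : 0 ≤ R₁) (hR₂ : 0 < R₂) (hε : 0 < ε) :
    0 < constEta d R₁ R₂ m ε :=
  lt_min (div_pos hε (constP_pos hR₁ hR₂)) (by linarith [two_le_two_pi_rpow hd])

/-- The defining equation of `W₋₁`, at `t = -W₋₁(-η₁^(2/d) / (2πe))`, in the form that matches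
Chernoff's bound. The bound `η₁ ≤ (2π)^(d/2)` puts the argument into the domain of `W₋₁`. -/
theorem exists_constH_eq_sqrt (hd : 0 < d) (hR₁ : 0 ≤ R₁) (hR₂ : 0 < R₂) (hε : 0 < ε) :
    ∃ t : ℝ, 1 ≤ t ∧ constH d R₁ R₂ m ε = Real.sqrt (d * t) ∧
      (t * Real.exp (1 - t)) ^ ((d : ℝ) / 2) =
        constEta d R₁ R₂ m ε / (2 * Real.pi) ^ ((d : ℝ) / 2) := by
  set η := constEta d R₁ R₂ m ε with hη
  have hd0 : (0 : ℝ) < d := Nat.cast_pos.2 hd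
  have hη0 : 0 < η := constEta_pos hd hR₁ hR₂ hε
  have hpi : 0 < 2 * Real.pi := by positivity
  have hη1 : η ≤ (2 * Real.pi) ^ ((d : ℝ) / 2) := (min_le_right _ _).trans (by linarith)
  have hpow : η ^ (2 / (d : ℝ)) ≤ 2 * Real.pi := by
    calc η ^ (2 / (d : ℝ)) ≤ ((2 * Real.pi) ^ ((d : ℝ) / 2)) ^ (2 / (d : ℝ)) :=
          Real.rpow_le_rpow hη0.le hη1 (by positivity)
      _ = 2 * Real.pi := by
          rw [← Real.rpow_mul hpi.le, show (d : ℝ) / 2 * (2 / d) = 1 by field_simp,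
            Real.rpow_one]
  have hpos : 0 < η ^ (2 / (d : ℝ)) := Real.rpow_pos_of_pos hη0 _
  obtain ⟨hW1, hW2⟩ := lambertWNegOne_spec
    (y := -(η ^ (2 / (d : ℝ)) / (2 * Real.pi * Real.exp 1)))
    (by
      rw [neg_le_neg_iff, div_le_div_iff₀ (by positivity) (Real.exp_pos 1), one_mul]
      exact mul_le_mul_of_nonneg_right hpow (Real.exp_pos 1).le)
    (by rw [neg_lt_zero]; positivity)
  set W := lambertWNegOne (-(η ^ (2 / (d : ℝ)) / (2 * Real.pi * Real.exp 1))) with hW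
  refine ⟨-W, by linarith, ?_, ?_⟩
  · rw [constH, ← hη, ← hW, mul_neg]
  · have h3 : -W * Real.exp (1 - -W) = η ^ (2 / (d : ℝ)) / (2 * Real.pi) := by
      calc -W * Real.exp (1 - -W) = -(W * Real.exp W) * Real.exp 1 := by
            rw [sub_neg_eq_add, Real.exp_add]
            ring
        _ = _ := by
            rw [hW2, neg_neg]
            field_simp
    rw [h3, Real.div_rpow hpos.le hpi.le, ← Real.rpow_mul hη0.le,
      show 2 / (d : ℝ) * (d / 2) = 1 by field_simp, Real.rpow_one]

theorem constH_pos (hd : 0 < d) (hR₁ : 0 ≤ R₁) (hR₂ : 0 < R₂) (hε : 0 < ε) :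
    0 < constH d R₁ R₂ m ε := by
  obtain ⟨t, ht, h, -⟩ := exists_constH_eq_sqrt (m := m) hd hR₁ hR₂ hε
  have hd0 : (0 : ℝ) < d := Nat.cast_pos.2 hd
  rw [h, Real.sqrt_pos]
  positivity

/-- The radius `H` is the one at which Chernoff's bound for the Gaussian tail equals
`η₁ / (2π)^(d/2)`. -/
theorem stdGaussian_constH_lt_norm_le (hd : 0 < d) (hR₁ : 0 ≤ R₁) (hR₂ : 0 < R₂) (hε : 0 < ε) :
    (stdGaussian (EuclideanSpace ℝ (Fin d))).real {u | constH d R₁ R₂ m ε < ‖u‖} ≤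
      constEta d R₁ R₂ m ε / (2 * Real.pi) ^ ((d : ℝ) / 2) := by
  obtain ⟨t, ht, h, h'⟩ := exists_constH_eq_sqrt (m := m) hd hR₁ hR₂ hε
  have htail := stdGaussian_norm_tail_le (E := EuclideanSpace ℝ (Fin d)) ht
  rw [finrank_euclideanSpace_fin, h'] at htail
  refine le_trans (measureReal_mono fun u hu => ?_) htail
  rw [h] at hu
  exact (Real.sqrt_le_left (norm_nonneg u)).1 (le_of_lt hu)

theorem sigmaBar_pos (hd : 0 < d) (hR₁ : 0 ≤ R₁) (hR₂ : 0 < R₂) (hm : R₁ = 0 ↔ m = 0)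
    (hδ : 0 < δ) (hε : 0 < ε) : 0 < sigmaBar d R₁ R₂ m δ ε := by
  have h1 : 0 < min 1 (δ / constH d R₁ R₂ m ε) :=
    lt_min one_pos (div_pos hδ (constH_pos hd hR₁ hR₂ hε))
  have hd0 : (0 : ℝ) < d := Nat.cast_pos.2 hd
  unfold sigmaBar
  split_ifs with h
  · exact h1
  · have : 0 < R₁ := lt_of_le_of_ne hR₁ fun h0 => h (hm.1 h0.symm)
    exact lt_min (by positivity) h1

theorem mul_constH_le_of_le_sigmaBar (hd : 0 < d) (hR₁ : 0 ≤ R₁) (hR₂ : 0 < R₂) (hε : 0 < ε)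
    {σ : ℝ} (hσ : σ ≤ sigmaBar d R₁ R₂ m δ ε) : σ * constH d R₁ R₂ m ε ≤ δ := by
  rw [← le_div_iff₀ (constH_pos hd hR₁ hR₂ hε)]
  refine hσ.trans ?_
  unfold sigmaBar
  split_ifs
  · exact min_le_right _ _
  · exact (min_le_right _ _).trans (min_le_right _ _)

/-- The term in `R₁` of `𝒫`, in a form that is free of the case distinction on `m`: for `m = 0`
the truncated exponent `m - 1` does not matter, as then `R₁ = 0`. -/
theorem two_pow_succ_mul_eq (hm : R₁ = 0 ↔ m = 0) (M : ℝ) :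
    2 ^ (m + 1) * R₁ * M = 4 * (R₁ * 2 ^ (m - 1) * M) := by
  rcases Nat.eq_zero_or_pos m with h | h
  · rw [hm.2 h]
    ring
  · obtain ⟨k, rfl⟩ := Nat.exists_eq_add_of_le' h
    rw [Nat.add_sub_cancel]
    ring

theorem mul_pow_le_of_le_sigmaBar (hd : 0 < d) (hR₁ : 0 ≤ R₁) (hm : R₁ = 0 ↔ m = 0)
    (hε : 0 < ε) {σ : ℝ} (hσ0 : 0 < σ) (hσ : σ ≤ sigmaBar d R₁ R₂ m δ ε) :
    R₁ * 2 ^ (m - 1) * σ ^ m * ((m : ℝ) + d) ^ ((m : ℝ) / 2) ≤ ε / 4 := by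
  have hd0 : (0 : ℝ) < d := Nat.cast_pos.2 hd
  rcases Nat.eq_zero_or_pos m with h | h
  · rw [hm.2 h]
    simp only [zero_mul]
    positivity
  · have hR : 0 < R₁ := lt_of_le_of_ne hR₁ fun h0 => h.ne' (hm.1 h0.symm)
    set M := ((m : ℝ) + d) ^ ((m : ℝ) / 2) with hM
    have hM0 : 0 < M := by positivity
    have hm0 : (m : ℝ) ≠ 0 := Nat.cast_ne_zero.2 h.ne'
    have h1 : σ ≤ (ε / (2 ^ (m + 1) * R₁ * M)) ^ (1 / (m : ℝ)) := by
      rw [sigmaBar, if_neg h.ne'] at hσ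
      exact hσ.trans (min_le_left _ _)
    have h2 : σ ^ m ≤ ε / (2 ^ (m + 1) * R₁ * M) := by
      calc σ ^ m ≤ ((ε / (2 ^ (m + 1) * R₁ * M)) ^ (1 / (m : ℝ))) ^ m :=
            pow_le_pow_left₀ hσ0.le h1 m
        _ = _ := by
            rw [one_div, Real.rpow_inv_natCast_pow (by positivity) h.ne']
    rw [le_div_iff₀ (by positivity), two_pow_succ_mul_eq hm] at h2
    linarith

end GaussSmooth

/-! ### The distance from the gradient of the smoothing to the Goldstein subdifferential -/

/-- For a function with `‖g‖ ≤ a + b k`, conditioning on an event `A` of probability at least one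
half changes the mean by at most `2 a P(Aᶜ) + b E[k]`. -/
theorem MeasureTheory.norm_integral_sub_setAverage_le {Ω E : Type*} [MeasurableSpace Ω]
    {μ : Measure Ω} [IsProbabilityMeasure μ] [NormedAddCommGroup E] [NormedSpace ℝ E]
    {g : Ω → E} {k : Ω → ℝ} {a b : ℝ} {A : Set Ω} (hA : MeasurableSet A)
    (hg : Integrable g μ) (hk : Integrable k μ) (hk0 : ∀ u, 0 ≤ k u) (hb : 0 ≤ b)
    (hgk : ∀ u, ‖g u‖ ≤ a + b * k u) (hq : μ.real Aᶜ ≤ 1 / 2) :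
    ‖∫ u, g u ∂μ - ⨍ u in A, g u ∂μ‖ ≤ 2 * a * μ.real Aᶜ + b * ∫ u, k u ∂μ := by
  set q := μ.real Aᶜ with hqdef
  have hp : μ.real A = 1 - q := by
    rw [hqdef, probReal_compl_eq_one_sub hA]
    ring
  have hp0 : 0 < 1 - q := by linarith
  have hq0 : 0 ≤ q := measureReal_nonneg
  have hset : ∀ S : Set Ω, ‖∫ u in S, g u ∂μ‖ ≤ a * μ.real S + b * ∫ u in S, k u ∂μ := fun S =>
    calc ‖∫ u in S, g u ∂μ‖ ≤ ∫ u in S, (a + b * k u) ∂μ :=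
          norm_integral_le_of_norm_le
            ((integrable_const a).add (hk.integrableOn.const_mul b))
            (Filter.Eventually.of_forall hgk)
      _ = _ := by
          rw [integral_add (integrable_const a) (hk.integrableOn.const_mul b), integral_const,
            integral_const_mul, measureReal_restrict_apply_univ, smul_eq_mul, mul_comm a]
  have hkA : 0 ≤ ∫ u in A, k u ∂μ := integral_nonneg hk0
  have hsplit : ∫ u, g u ∂μ - ⨍ u in A, g u ∂μ =
      (∫ u in Aᶜ, g u ∂μ) - (q / (1 - q)) • ∫ u in A, g u ∂μ := by
    rw [setAverage_eq, hp, ← integral_add_compl hA hg]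
    have : q / (1 - q) = (1 - q)⁻¹ - 1 := by
      field_simp
      ring
    rw [this, sub_smul, one_smul]
    abel
  have hr0 : 0 ≤ q / (1 - q) := by positivity
  have hr1 : q / (1 - q) ≤ 1 := by
    rw [div_le_one hp0]
    linarith
  have h1 := hset Aᶜ
  have h2 := mul_le_mul_of_nonneg_left (hset A) hr0
  rw [hp] at h2
  have h3 : q / (1 - q) * (a * (1 - q) + b * ∫ u in A, k u ∂μ) ≤ a * q + b * ∫ u in A, k u ∂μ := by
    rw [mul_add]
    have h4 : q / (1 - q) * (a * (1 - q)) = a * q := by field_simp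
    have h5 := mul_le_of_le_one_left (mul_nonneg hb hkA) hr1
    linarith
  rw [hsplit, ← integral_add_compl hA hk]
  refine (norm_sub_le _ _).trans ?_
  rw [norm_smul, Real.norm_eq_abs, abs_of_nonneg hr0]
  linarith

namespace GaussSmooth

variable {d : ℕ} {f : EuclideanSpace ℝ (Fin d) → ℝ} {R₁ R₂ ε δ : ℝ} {m : ℕ}

theorem IsSPBWith.norm_gradient_comp_le (hf : IsSPBWith f R₁ R₂ m) {σ : ℝ} (hσ : 0 < σ)
    (x u : EuclideanSpace ℝ (Fin d)) :
    ‖gradient f (x + σ • u)‖ ≤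
      (R₁ * 2 ^ (m - 1) * ‖x‖ ^ m + R₂) + R₁ * 2 ^ (m - 1) * σ ^ m * ‖u‖ ^ m := by
  refine (hf.norm_gradient_le _).trans ?_
  have h1 : ‖x + σ • u‖ ^ m ≤ 2 ^ (m - 1) * (‖x‖ ^ m + (σ * ‖u‖) ^ m) :=
    (pow_le_pow_left₀ (norm_nonneg _) (norm_add_smul_le hσ x u) m).trans
      (add_pow_le (norm_nonneg x) (by positivity) m)
  have h2 := mul_le_mul_of_nonneg_left h1 hf.nonneg_R₁
  rw [mul_pow] at h2
  linarith

theorem mem_add_smul_closedBall_of_norm_sub_le {E : Type*} [NormedAddCommGroup E]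
    [NormedSpace ℝ E] {S : Set E} {z w : E} {r : ℝ} (hw : w ∈ S) (h : ‖z - w‖ ≤ r) :
    z ∈ S + r • Metric.closedBall (0 : E) 1 := by
  refine ⟨w, hw, z - w, ?_, add_sub_cancel w z⟩
  rw [smul_unitClosedBall_of_nonneg ((norm_nonneg _).trans h)]
  exact mem_closedBall_zero_iff.2 h

theorem setAverage_gradient_mem_closure_goldsteinSubdiff (hf : IsSPBWith f R₁ R₂ m) {σ H : ℝ}
    (hσ : 0 < σ) (hH : σ * H ≤ δ) (x : EuclideanSpace ℝ (Fin d))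
    (h0 : stdGaussian (EuclideanSpace ℝ (Fin d)) {u | ‖u‖ ≤ H} ≠ 0) :
    (⨍ u in {u | ‖u‖ ≤ H}, gradient f (x + σ • u) ∂(stdGaussian (EuclideanSpace ℝ (Fin d)))) ∈
      closure (goldsteinSubdiff f δ x) := by
  refine (convex_convexHull ℝ _).set_average_mem_closure h0 (measure_ne_top _ _) ?_
    (hf.integrable_gradient hσ x).integrableOn
  have hmeas : MeasurableSet {u : EuclideanSpace ℝ (Fin d) | ‖u‖ ≤ H} :=
    measurableSet_le measurable_norm measurable_const
  rw [ae_restrict_iff' hmeas]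
  filter_upwards [ae_differentiableAt_add_smul hf.locallyLipschitz hσ x] with u hu huH
  refine subset_convexHull ℝ _ (Set.mem_biUnion ?_
    (gradient_mem_clarkeSubdiff hf.locallyLipschitz hu))
  rw [mem_closedBall_iff_norm, add_sub_cancel_left, norm_smul, Real.norm_eq_abs, abs_of_pos hσ]
  exact (mul_le_mul_of_nonneg_left huH hσ.le).trans hH

theorem gradient_gaussianSmoothing_mem (hd : 0 < d) (hf : IsSPBWith f R₁ R₂ m)
    (hδ : 0 < δ) (hε : 0 < ε) {σ : ℝ} (hσ : 0 < σ) (hσ' : σ ≤ sigmaBar d R₁ R₂ m δ ε)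
    (x : EuclideanSpace ℝ (Fin d)) :
    gradient (gaussianSmoothing f σ) x ∈ goldsteinSubdiff f δ x +
      ((1 + ‖x‖ ^ m) * ε) • Metric.closedBall (0 : EuclideanSpace ℝ (Fin d)) 1 := by
  have hR₁ := hf.nonneg_R₁
  have hR₂ := hf.pos_R₂
  have hm := hf.R₁_eq_zero_iff
  have hd1 : (1 : ℝ) ≤ d := Nat.one_le_cast.2 hd
  have hm0 : (0 : ℝ) ≤ m := Nat.cast_nonneg m
  have hP0 : 0 < constP d R₁ R₂ m := constP_pos hR₁ hR₂
  have hP : constP d R₁ R₂ m =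
      4 * R₂ + 4 * (R₁ * 2 ^ (m - 1) * ((m : ℝ) + d) ^ ((m : ℝ) / 2)) := by
    rw [constP, two_pow_succ_mul_eq hm]
  have hb := mul_pow_le_of_le_sigmaBar hd hR₁ hm hε hσ hσ'
  have hM1 : 1 ≤ ((m : ℝ) + d) ^ ((m : ℝ) / 2) := Real.one_le_rpow (by linarith) (by positivity)
  set M := ((m : ℝ) + d) ^ ((m : ℝ) / 2) with hM
  set c := R₁ * 2 ^ (m - 1) with hc
  set X := ‖x‖ ^ m with hX
  have hX0 : 0 ≤ X := by positivity
  have hc0 : 0 ≤ c := by positivity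
  have hcM : c ≤ c * M := le_mul_of_one_le_right hc0 hM1
  set K := ∫ u : EuclideanSpace ℝ (Fin d), ‖u‖ ^ m ∂(stdGaussian (EuclideanSpace ℝ (Fin d)))
    with hK
  have hKM : K ≤ M := by
    have := integral_norm_pow_le (E := EuclideanSpace ℝ (Fin d))
      (by rwa [finrank_euclideanSpace_fin]) m
    rwa [finrank_euclideanSpace_fin] at this
  have hbK : c * σ ^ m * K ≤ ε / 4 :=
    (mul_le_mul_of_nonneg_left hKM (by positivity)).trans hb
  have hgk := hf.norm_gradient_comp_le hσ x
  have hint := hf.integrable_gradient hσ x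
  rw [gradient_gaussianSmoothing_eq_integral_gradient hf hσ x]
  rcases le_or_gt (constP d R₁ R₂ m) ε with hcase | hcase
  · -- for large `ε` any Clarke subgradient at `x` itself is close enough
    obtain ⟨ζ, hζ⟩ := clarkeSubdiff_nonempty hf.locallyLipschitz x
    have hζG : ζ ∈ goldsteinSubdiff f δ x := subset_convexHull ℝ _
      (Set.mem_biUnion (Metric.mem_closedBall_self hδ.le) hζ)
    refine mem_add_smul_closedBall_of_norm_sub_le hζG ((norm_sub_le _ _).trans ?_)
    have h1 : ‖∫ u, gradient f (x + σ • u) ∂(stdGaussian (EuclideanSpace ℝ (Fin d)))‖ ≤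
        (c * X + R₂) + c * σ ^ m * K := by
      have hi : Integrable (fun u : EuclideanSpace ℝ (Fin d) => c * σ ^ m * ‖u‖ ^ m)
        (stdGaussian (EuclideanSpace ℝ (Fin d))) := (integrable_norm_pow m).const_mul _
      refine (norm_integral_le_of_norm_le ((integrable_const (c * X + R₂)).add hi)
        (Filter.Eventually.of_forall hgk)).trans (le_of_eq ?_)
      rw [integral_add' (integrable_const _) hi, integral_const_mul, integral_const, probReal_univ,
        one_smul]
    have h2 := hf.bound x ζ hζ
    have h3 : R₁ ≤ c := le_mul_of_one_le_right hR₁ (one_le_pow₀ one_le_two)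
    have h4 := mul_le_mul_of_nonneg_right h3 hX0
    have h5 : 4 * c * X ≤ ε * X := mul_le_mul_of_nonneg_right (by linarith) hX0
    have h6 : 0 ≤ ε * X := by positivity
    have h7 := mul_nonneg hc0 hX0
    linarith
  · -- otherwise the ball of radius `H` carries at least half of the mass
    set H := constH d R₁ R₂ m ε with hH
    set A : Set (EuclideanSpace ℝ (Fin d)) := {u | ‖u‖ ≤ H} with hA
    have hmeas : MeasurableSet A := measurableSet_le measurable_norm measurable_const
    have hAc : Aᶜ = {u | H < ‖u‖} := by
      ext u
      simp [hA]
    have htail := stdGaussian_constH_lt_norm_le (m := m) hd hR₁ hR₂ hε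
    rw [← hH, ← hAc] at htail
    set q := (stdGaussian (EuclideanSpace ℝ (Fin d))).real Aᶜ with hq
    have hq0 : 0 ≤ q := measureReal_nonneg
    have hqP : q * 2 ≤ ε / constP d R₁ R₂ m := by
      have h2 := two_le_two_pi_rpow hd
      rw [le_div_iff₀ (by linarith)] at htail
      have h3 := mul_le_mul_of_nonneg_left h2 hq0
      have h4 : constEta d R₁ R₂ m ε ≤ ε / constP d R₁ R₂ m := min_le_left _ _
      linarith
    have hq1 : q ≤ 1 / 2 := by
      have := (div_lt_one hP0).2 hcase
      linarith
    have hA0 : stdGaussian (EuclideanSpace ℝ (Fin d)) A ≠ 0 := fun h0 => by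
      have h1 := probReal_compl_eq_one_sub (μ := stdGaussian (EuclideanSpace ℝ (Fin d))) hmeas
      rw [measureReal_def _ A, h0, ENNReal.toReal_zero, ← hq] at h1
      linarith
    have hw := setAverage_gradient_mem_closure_goldsteinSubdiff hf hσ
      (mul_constH_le_of_le_sigmaBar hd hR₁ hR₂ hε hσ') x hA0
    have hdiff := norm_integral_sub_setAverage_le hmeas hint (integrable_norm_pow m)
      (fun u => by positivity) (by positivity) hgk hq1
    -- the estimate is strict, so that the closure in `hw` is harmless
    have hlt : 2 * (c * X + R₂) * q + c * σ ^ m * K < (1 + X) * ε := by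
      have h1 : 4 * (c * X + R₂) ≤ constP d R₁ R₂ m * (1 + X) := by
        have h2 := mul_le_mul_of_nonneg_right hcM hX0
        have h3 := mul_nonneg hR₂.le hX0
        have h4 := hc0.trans hcM
        rw [hP]
        linarith
      rw [le_div_iff₀ hP0] at hqP
      have h5 := mul_le_mul_of_nonneg_left h1 hq0
      have h6 := mul_le_mul_of_nonneg_right hqP (show 0 ≤ 1 + X by positivity)
      have h7 : 0 ≤ ε * X := by positivity
      linarith
    obtain ⟨w', hw'G, hw'⟩ := Metric.mem_closure_iff.1 hw _ (sub_pos.2 (hdiff.trans_lt hlt))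
    refine mem_add_smul_closedBall_of_norm_sub_le hw'G ?_
    rw [dist_eq_norm] at hw'
    exact (norm_sub_le_norm_sub_add_norm_sub _ _ _).trans (by linarith)

end GaussSmooth

theorem theorem3p6 {d : ℕ} (hd : 0 < d) (f : EuclideanSpace ℝ (Fin d) → ℝ)
    (R₁ R₂ : ℝ) (m : ℕ) (hf : GaussSmooth.IsSPBWith f R₁ R₂ m) :
    -- well-definedness of `f_σ` and `∇f_σ`, and (i)
    (∀ σ : ℝ, 0 < σ → ∀ x : EuclideanSpace ℝ (Fin d),
      Integrable (fun u => f (x + σ • u)) (stdGaussian (EuclideanSpace ℝ (Fin d))) ∧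
      DifferentiableAt ℝ (GaussSmooth.gaussianSmoothing f σ) x ∧
      Integrable (fun u => f (x + σ • u) • u) (stdGaussian (EuclideanSpace ℝ (Fin d))) ∧
      gradient (GaussSmooth.gaussianSmoothing f σ) x =
        σ⁻¹ • ∫ u, f (x + σ • u) • u ∂(stdGaussian (EuclideanSpace ℝ (Fin d))) ∧
      Integrable
        ({u : EuclideanSpace ℝ (Fin d) | DifferentiableAt ℝ f (x + σ • u)}.indicator
          (fun u => gradient f (x + σ • u)))
        (stdGaussian (EuclideanSpace ℝ (Fin d))) ∧
      gradient (GaussSmooth.gaussianSmoothing f σ) x =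
        ∫ u, {u : EuclideanSpace ℝ (Fin d) | DifferentiableAt ℝ f (x + σ • u)}.indicator
          (fun u => gradient f (x + σ • u)) u ∂(stdGaussian (EuclideanSpace ℝ (Fin d)))) ∧
    -- (ii)
    (∀ δ ε : ℝ, 0 < δ → 0 < ε →
      0 < GaussSmooth.sigmaBar d R₁ R₂ m δ ε ∧
      ∀ σ : ℝ, 0 < σ → σ ≤ GaussSmooth.sigmaBar d R₁ R₂ m δ ε →
        ∀ x : EuclideanSpace ℝ (Fin d),
          gradient (GaussSmooth.gaussianSmoothing f σ) x ∈
            GaussSmooth.goldsteinSubdiff f δ x +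
              ((1 + ‖x‖ ^ m) * ε) • Metric.closedBall (0 : EuclideanSpace ℝ (Fin d)) 1) := by
  refine ⟨fun σ hσ x => ?_, fun δ ε hδ hε => ⟨?_, fun σ hσ hσ' x => ?_⟩⟩
  · rw [GaussSmooth.indicator_differentiableAt_gradient]
    exact ⟨hf.integrable_comp hσ x,
      (GaussSmooth.hasFDerivAt_gaussianSmoothing hf hσ x).2.differentiableAt,
      hf.integrable_comp_smul hσ x,
      GaussSmooth.gradient_gaussianSmoothing_eq_integral_smul hf hσ x,
      hf.integrable_gradient hσ x,
      GaussSmooth.gradient_gaussianSmoothing_eq_integral_gradient hf hσ x⟩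
  · exact GaussSmooth.sigmaBar_pos hd hf.nonneg_R₁ hf.pos_R₂ hf.R₁_eq_zero_iff hδ hε
  · exact GaussSmooth.gradient_gaussianSmoothing_mem hd hf hδ hε hσ hσ' x
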